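/- Let $K$ be a field, $H$ a finite dimensional $K$-bialgebra with comultiplication $\Delta$ and counit $\epsilon$, and $L/K$ a finite separable field extension. Assume that $L/K$ is $H$-Galois, that is, $L$ is a left $H$-module algebra over $K$ and the canonical map $L\otimes_K H\to \mathrm{End}_K(L)$, $x\otimes h\mapsto (y\mapsto x(h\cdot y))$, is bijective. For an intermediate field $K\subseteq L_0\subseteq L$ put $J(L_0)=\{h\in H : h\cdot x=0 \text{ for all } x\in L_0\}$, which is a left ideal of $H$. Call $L_0$ an $H$-subextension if the canonical map $L\otimes_K H/J(L_0)\to \mathrm{Hom}_K(L_0,L)$, $x\otimes\bar h\mapsto (y\mapsto x(h\cdot y))$, is bijective; call it $H$-stable if $H\cdot L_0\subseteq L_0$, and $H$-normal if it is an $H$-stable $H$-subextension. For $I\subseteq H$ put $L^I=\{x\in L : h\cdot x=\epsilon(h)x \text{ for all } h\in I\}$. A two-sided coideal of $H$ is a $K$-subspace $I$ with $\epsilon(I)=0$ and $\Delta(I)\subseteq H\otimes I+I\otimes H$. A Hopf ideal of $H$ is a two-sided ideal and two-sided coideal that is stable under the antipode of $H$ (the existence of an antipode, which is then unique, being part of the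 assertion that something is a Hopf ideal). Then $L_0\mapsto J(L_0)$ and $I\mapsto L^I$ are mutually inverse, inclusion-reversing bijections between the set of $H$-subextensions $L_0$ of $L/K$ and the set of left ideals $I$ of $H$ that are two-sided coideals. Moreover, they restrict to mutually inverse bijections between the set of $H$-normal intermediate fields of $L/K$ and the set of Hopf ideals of $H$. -/

import Mathlib

open scoped TensorProduct

noncomputable section

namespace HopfGalois

section Action

variable (K H L : Type*) [Field K] [Ring H] [Bialgebra K H] [Field L] [Algebra K L]
  [Module H L] [IsScalarTower K H L]

/-- The `K`-linear map `H → End_K(L)`, `h ↦ (x ↦ h • x)`, of a left `H`-module `L`. -/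
def act : H →ₗ[K] (L →ₗ[K] L) :=
  LinearMap.mk₂ K (fun (h : H) (x : L) => h • x)
    (fun h h' x => add_smul h h' x)
    (fun c h x => smul_assoc c h x)
    (fun h x y => smul_add h x y)
    (fun c h x => smul_comm h c x)

@[simp]
theorem act_apply (h : H) (x : L) : act K H L h x = h • x := rfl

/-- `L` is a left `H`-module algebra over `K`:
`h • (x y) = ∑ (h₁ • x) (h₂ • y)` and `h • 1 = ε(h) 1`. -/
structure IsModuleAlgebra : Prop where
  smul_mul : ∀ (h : H) (x y : L),
    h • (x * y) =
      LinearMap.mul' K L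
        (TensorProduct.map ((act K H L).flip x) ((act K H L).flip y)
          (Coalgebra.comul (R := K) h))
  smul_one : ∀ h : H, h • (1 : L) = algebraMap K L (Coalgebra.counit (R := K) h)

/-- The canonical (Galois) map `can : L ⊗ H → End_K(L)`, `can (x ⊗ h) y = x (h • y)`. -/
def can : L ⊗[K] H →ₗ[L] (L →ₗ[K] L) :=
  (act K H L).liftBaseChange L

theorem can_tmul (x : L) (h : H) (y : L) : can K H L (x ⊗ₜ[K] h) y = x * (h • y) := by
  simp [can]

/-- The extension `L / K` is `H`-Galois: `L` is a left `H`-module algebra and the canonical map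
`L ⊗ H → End_K(L)` is bijective. -/
structure IsHopfGalois : Prop where
  isModuleAlgebra : IsModuleAlgebra K H L
  bijective_can : Function.Bijective (can K H L)

variable {K L}

/-- `J(L₀) = {h ∈ H | h • x = 0 for all x ∈ L₀}`; it is always a left ideal. -/
def annihilator (L₀ : IntermediateField K L) : Ideal H where
  carrier := {h | ∀ x ∈ L₀, h • x = 0}
  zero_mem' := fun x _ => zero_smul H x
  add_mem' := fun {a b} ha hb x hx => by rw [add_smul, ha x hx, hb x hx, add_zero]
  smul_mem' := fun c h hh x hx => by rw [smul_eq_mul, mul_smul, hh x hx, smul_zero]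

/-- The map `H / J(L₀) → Hom_K(L₀, L)` induced by the action of `H` on `L`. -/
def actQuot (L₀ : IntermediateField K L) :
    (H ⧸ (annihilator H L₀).restrictScalars K) →ₗ[K] (L₀ →ₗ[K] L) :=
  ((annihilator H L₀).restrictScalars K).liftQ
    ((LinearMap.lcomp K L L₀.val.toLinearMap) ∘ₗ act K H L)
    (fun _ hh => LinearMap.ext fun x => hh x x.2)

theorem actQuot_mk (L₀ : IntermediateField K L) (h : H) (y : L₀) :
    actQuot H L₀ (Submodule.Quotient.mk h) y = h • (y : L) := rfl

/-- The canonical map `can₀ : L ⊗ H / J(L₀) → Hom_K(L₀, L)`, `can₀ (x ⊗ h̄) y = x (h • y)`. -/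
def canQuot (L₀ : IntermediateField K L) :
    L ⊗[K] (H ⧸ (annihilator H L₀).restrictScalars K) →ₗ[L] (L₀ →ₗ[K] L) :=
  (actQuot H L₀).liftBaseChange L

theorem canQuot_tmul_mk (L₀ : IntermediateField K L) (x : L) (h : H) (y : L₀) :
    canQuot H L₀ (x ⊗ₜ[K] Submodule.Quotient.mk h) y = x * (h • (y : L)) := by
  simp [canQuot, actQuot_mk]

/-- `L₀ / K` is an `H`-subextension: the canonical map `L ⊗ H / J(L₀) → Hom_K(L₀, L)` is
bijective. -/
def IsHSubextension (L₀ : IntermediateField K L) : Prop :=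
  Function.Bijective (canQuot H L₀)

/-- `L₀` is `H`-stable: `H • L₀ ⊆ L₀`. -/
def IsHStable (L₀ : IntermediateField K L) : Prop :=
  ∀ (h : H), ∀ x ∈ L₀, h • x ∈ L₀

/-- `L₀` is `H`-normal: an `H`-stable `H`-subextension. -/
def IsHNormal (L₀ : IntermediateField K L) : Prop :=
  IsHSubextension H L₀ ∧ IsHStable H L₀

variable {H}

variable (K L) in
/-- The space of invariants `L^F = {x ∈ L | h • x = ε(h) x for all h ∈ F}` of a subset
`F` of `H`. -/
def invariants (F : Set H) : Submodule K L where
  carrier := {x | ∀ h ∈ F, h • x = Coalgebra.counit (R := K) h • x}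
  zero_mem' := fun h _ => by rw [smul_zero, smul_zero]
  add_mem' := fun {a b} ha hb h hh => by rw [smul_add, smul_add, ha h hh, hb h hh]
  smul_mem' := fun c x hx h hh => by rw [smul_comm h c x, hx h hh, smul_comm]

theorem mem_invariants {F : Set H} {x : L} :
    x ∈ invariants K L F ↔ ∀ h ∈ F, h • x = Coalgebra.counit (R := K) h • x := Iff.rfl

end Action

section Ideals

variable (K : Type*) {H : Type*} [Field K] [Ring H] [Bialgebra K H]

/-- A left ideal of `H` that is a two-sided coideal: `ε(I) = 0` and
`Δ(I) ⊆ H ⊗ I + I ⊗ H`. (An `Ideal` of a noncommutative ring is a left ideal.) -/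
def IsLeftIdealCoideal (I : Ideal H) : Prop :=
  (I.restrictScalars K).IsCoideal

/-- `S` is an antipode of the bialgebra `H`: `∑ S(h₁) h₂ = ε(h) 1 = ∑ h₁ S(h₂)`. -/
structure IsAntipode (S : H →ₗ[K] H) : Prop where
  left : ∀ h : H, LinearMap.mul' K H (S.rTensor H (Coalgebra.comul (R := K) h)) =
    algebraMap K H (Coalgebra.counit (R := K) h)
  right : ∀ h : H, LinearMap.mul' K H (S.lTensor H (Coalgebra.comul (R := K) h)) =
    algebraMap K H (Coalgebra.counit (R := K) h)

/-- A Hopf ideal: a two-sided ideal and two-sided coideal that is stable under the antipode of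
`H`. The antipode is not part of the data of a bialgebra; it is unique when it exists, and its
existence is part of this definition. -/
structure IsHopfIdeal (I : Ideal H) : Prop where
  isTwoSided : I.IsTwoSided
  isCoideal : IsLeftIdealCoideal K I
  antipode_mem : ∃ S : H →ₗ[K] H, IsAntipode K S ∧ ∀ h ∈ I, S h ∈ I

end Ideals

end HopfGalois

end

/-!
The extension `L / K` is `H`-Galois when `can : L ⊗ H → End_K(L)` is an isomorphism. For a subset
`F` of `H`, let `L·F` denote the `L`-subspace of `End_K(L)` spanned by the action of `F`. Everything
is linear algebra over `L` inside `End_K(L)`.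

*From ideals to fields.* Let `I` be a left ideal and coideal. As `ε(I) = 0`, the space `L^I` is the
common kernel of the operators in `I`; it is a subalgebra, hence a field, because
`h (x y) = ∑ (h₁ x) (h₂ y)` and `Δ(I) ⊆ H ⊗ I + I ⊗ H` (`smul_mul_eq_zero`, `fixedField`). Since `I`
is a left ideal and `h (c f) = ∑ (h₁ c) (h₂ f)`, the space `L·I` is a left ideal of
`End_K(L) = L·H` (`comp_mem_span`). A left ideal of the endomorphism ring of a finite dimensional
vector space consists of all endomorphisms vanishing on its common kernel
(`mem_of_forall_comp_mem`), so `L·I` is the set of all `g` that vanish on `L^I`. As `can` is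
injective, `I` can be recovered from `L·I`, and therefore `J(L^I) = I` (`annihilator_fixedField`).

*From fields to ideals.* An intermediate field `L₀` is an `H`-subextension exactly when every
endomorphism vanishing on `L₀` lies in `L·J(L₀)` (`isHSubextension_iff`). This shows at once that
`L^I` is an `H`-subextension and that `L^J(L₀) = L₀` for every `H`-subextension `L₀`. For such `L₀`,
injectivity of `L ⊗ H / J → Hom_K(L₀, L)` makes `H / J ⊗ H / J → Hom_K(L₀ ⊗ L₀, L)` injective too;
it sends the image of `Δ(h)` to `x ⊗ y ↦ h (x y)`, so `J` is a coideal
(`isLeftIdealCoideal_annihilator`).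

*Normality.* `H`-stable fields correspond to two-sided ideals, and it remains to find an antipode
preserving a given two-sided coideal ideal `I`. The map `g ⊗ h ↦ ∑ g₁ ⊗ g₂ h` is injective, because
its composite with `H ⊗ H → Hom_K(L ⊗ L, L)` is `g ⊗ h ↦ (y ⊗ z ↦ g (y (h z)))`
(`galoisMap_injective`). By finite dimension it is bijective, which makes `f ↦ f * id` injective on
the convolution algebra `End_K(H)`. This operator preserves the subspace of all `f` with
`f(I) ⊆ I`, which contains the convolution unit, so a left inverse of `id` exists in that subspace,
and it is two-sided (`exists_isAntipode_mapsTo`).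
-/

open scoped TensorProduct

namespace HopfGalois

/-! ### Base change and endomorphisms of vector spaces -/

section LinearAlgebra

variable {K L V M : Type*} [Field K] [Field L] [Algebra K L] [AddCommGroup V] [Module K V]
  [AddCommGroup M] [Module K M] [Module L M] [IsScalarTower K L M]

theorem linearIndependent_of_injective_liftBaseChange {ι : Type*} (f : V →ₗ[K] M)
    (hf : Function.Injective (f.liftBaseChange L)) (b : Module.Basis ι K V) :
    LinearIndependent L (fun i => f (b i)) := by
  have h := (b.baseChange L).linearIndependent.map' _ (LinearMap.ker_eq_bot.2 hf)
  have he : f.liftBaseChange L ∘ b.baseChange L = fun i => f (b i) := by ext i; simp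
  rwa [he] at h

theorem map_baseChange_liftBaseChange (f : V →ₗ[K] M) (W : Submodule K V) :
    (W.baseChange L).map (f.liftBaseChange L) = Submodule.span L (f '' W) := by
  rw [Submodule.baseChange_eq_span, Submodule.map_span]
  congr 1
  ext m
  simp

theorem ker_baseChange_mkQ (W : Submodule K V) :
    LinearMap.ker (W.mkQ.baseChange L) = W.baseChange L := by
  ext t
  have h := lTensor_exact L (LinearMap.exact_subtype_mkQ W) W.mkQ_surjective t
  exact h

/-- Extending scalars to `L` loses no information on a subspace `W`: it can be recovered from the
`L`-span of its image. -/
theorem mem_of_apply_mem_span_image (f : V →ₗ[K] M)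
    (hf : Function.Injective (f.liftBaseChange L)) (W : Submodule K V) {v : V}
    (hv : f v ∈ Submodule.span L (f '' W)) : v ∈ W := by
  rw [← map_baseChange_liftBaseChange] at hv
  obtain ⟨t, ht, htv⟩ := hv
  have hte : t = 1 ⊗ₜ[K] v := hf (by rw [htv]; simp)
  rw [hte, SetLike.mem_coe, ← ker_baseChange_mkQ, LinearMap.mem_ker,
    LinearMap.baseChange_tmul] at ht
  exact (Submodule.Quotient.mk_eq_zero W).1
    (Module.FaithfullyFlat.tensorProduct_mk_injective (A := K) (B := L) (V ⧸ W) (by simpa using ht))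

/-- A left ideal of the endomorphism ring of a finite dimensional vector space contains every
endomorphism that vanishes on its common kernel: such an endomorphism factors through the map
`V → Vⁿ` given by a finite generating family of the left ideal. -/
theorem mem_of_forall_comp_mem [FiniteDimensional K V] (N : Submodule K (V →ₗ[K] V))
    (hN : ∀ (φ : V →ₗ[K] V), ∀ f ∈ N, φ ∘ₗ f ∈ N) (g : V →ₗ[K] V)
    (hg : ∀ x, (∀ f ∈ N, f x = 0) → g x = 0) : g ∈ N := by
  obtain ⟨n, s, hs⟩ : ∃ (n : ℕ) (s : Fin n → V →ₗ[K] V), Submodule.span K (Set.range s) = N :=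
    Submodule.fg_iff_exists_fin_generating_family.1 (IsNoetherian.noetherian N)
  let F : V →ₗ[K] (Fin n → V) := LinearMap.pi s
  have hF : LinearMap.ker F ≤ LinearMap.ker g := by
    intro x hx
    refine hg x fun f hf => ?_
    rw [← hs] at hf
    have hx' : ∀ i, s i x = 0 := fun i => congrFun hx i
    induction hf using Submodule.span_induction with
    | mem f hf => obtain ⟨i, rfl⟩ := hf; exact hx' i
    | zero => rfl
    | add f f' _ _ h h' => simp [h, h']
    | smul c f _ h => simp [h]
  obtain ⟨r, hr⟩ := ((LinearMap.ker F).liftQ F le_rfl).exists_leftInverse_of_injective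
    (Submodule.ker_liftQ_eq_bot' _ _ rfl)
  let G : (Fin n → V) →ₗ[K] V := (LinearMap.ker F).liftQ g hF ∘ₗ r
  have hG : g = ∑ i, (G ∘ₗ LinearMap.single K (fun _ => V) i) ∘ₗ s i := by
    ext x
    have h1 : r (F x) = Submodule.Quotient.mk x := LinearMap.congr_fun hr (Submodule.Quotient.mk x)
    have h2 : G (F x) = g x := by simp [G, h1]
    rw [← h2, LinearMap.sum_apply]
    conv_lhs => rw [← LinearMap.sum_single_apply (fun _ => V) (F x)]
    rw [map_sum]
    rfl
  rw [hG]
  exact Submodule.sum_mem _ fun i _ => hN _ _ (hs ▸ Submodule.subset_span ⟨i, rfl⟩)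

end LinearAlgebra

/-! ### The correspondence between subextensions and coideals -/

section Action

variable {K H L : Type*} [Field K] [Ring H] [Bialgebra K H] [Field L] [Algebra K L]
  [Module H L] [IsScalarTower K H L]

/-- The canonical map of `L₀` is compatible with the restriction `End_K(L) → Hom_K(L₀, L)`. -/
theorem canQuot_baseChange_mkQ (L₀ : IntermediateField K L) (t : L ⊗[K] H) (y : L₀) :
    canQuot H L₀ (((annihilator H L₀).restrictScalars K).mkQ.baseChange L t) y =
      can K H L t y := by
  induction t with
  | zero => simp
  | add t t' h h' => simp only [map_add, LinearMap.add_apply, h, h']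
  | tmul x h =>
    rw [LinearMap.baseChange_tmul, Submodule.mkQ_apply, canQuot_tmul_mk, can_tmul]

/-- `L₀` is an `H`-subextension iff the endomorphisms vanishing on `L₀` are spanned by `J(L₀)`.
Surjectivity of the canonical map of `L₀` is automatic; its injectivity is the stated condition. -/
theorem isHSubextension_iff (hG : Function.Bijective (can K H L)) (L₀ : IntermediateField K L) :
    IsHSubextension H L₀ ↔ ∀ g : L →ₗ[K] L, (∀ x ∈ L₀, g x = 0) →
      g ∈ Submodule.span L (act K H L '' (annihilator H L₀ : Set H)) := by
  set J := (annihilator H L₀).restrictScalars K with hJ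
  have hspan : (J.baseChange L).map (can K H L) =
      Submodule.span L (act K H L '' (annihilator H L₀ : Set H)) :=
    map_baseChange_liftBaseChange _ _
  rw [← hspan]
  constructor
  · intro h g hg
    obtain ⟨t, rfl⟩ := hG.2 g
    refine ⟨t, ?_, rfl⟩
    rw [SetLike.mem_coe, ← ker_baseChange_mkQ, LinearMap.mem_ker]
    refine h.1 (LinearMap.ext fun y => ?_)
    rw [canQuot_baseChange_mkQ, hg _ y.2, map_zero, LinearMap.zero_apply]
  · intro h
    constructor
    · rw [injective_iff_map_eq_zero]
      intro t ht
      obtain ⟨t, rfl⟩ := LinearMap.lTensor_surjective L J.mkQ_surjective t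
      have ht0 : ∀ y : L₀, can K H L t y = 0 := fun y => by
        rw [← canQuot_baseChange_mkQ]; exact LinearMap.congr_fun ht y
      obtain ⟨t', ht', hc⟩ := h (can K H L t) fun x hx => ht0 ⟨x, hx⟩
      rw [hG.1 hc, SetLike.mem_coe, ← ker_baseChange_mkQ] at ht'
      exact ht'
    · intro g
      obtain ⟨g', hg'⟩ := LinearMap.exists_extend (p := L₀.toSubalgebra.toSubmodule) g
      obtain ⟨t, rfl⟩ := hG.2 g'
      refine ⟨J.mkQ.baseChange L t, LinearMap.ext fun y => ?_⟩
      rw [canQuot_baseChange_mkQ]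
      exact LinearMap.congr_fun hg' y

theorem exists_vanishing_on_and_ne_zero (L₀ : IntermediateField K L) {x : L} (hx : x ∉ L₀) :
    ∃ g : L →ₗ[K] L, (∀ y ∈ L₀, g y = 0) ∧ g x ≠ 0 := by
  obtain ⟨f, hf, hf'⟩ :=
    Submodule.exists_le_ker_of_notMem (p := L₀.toSubalgebra.toSubmodule) (v := x) hx
  refine ⟨Algebra.linearMap K L ∘ₗ f, fun y hy => ?_, ?_⟩
  · have : f y = 0 := hf' hy
    simp [this]
  · simpa using hf

theorem apply_eq_zero_of_mem_span {F : Set H} {g : L →ₗ[K] L}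
    (hg : g ∈ Submodule.span L (act K H L '' F)) {x : L} (hx : ∀ h ∈ F, h • x = 0) : g x = 0 := by
  induction hg using Submodule.span_induction with
  | mem f hf => obtain ⟨h, hh, rfl⟩ := hf; exact hx h hh
  | zero => rfl
  | add f f' _ _ h h' => simp [h, h']
  | smul c f _ h => simp [h]

theorem mem_iff_forall_annihilator (hG : Function.Bijective (can K H L))
    {L₀ : IntermediateField K L} (h₀ : IsHSubextension H L₀) {x : L} :
    x ∈ L₀ ↔ ∀ h ∈ annihilator H L₀, h • x = 0 := by
  refine ⟨fun hx h hh => hh x hx, fun hx => ?_⟩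
  by_contra hx'
  obtain ⟨g, hg, hgx⟩ := exists_vanishing_on_and_ne_zero L₀ hx'
  exact hgx (apply_eq_zero_of_mem_span ((isHSubextension_iff hG L₀).1 h₀ g hg) hx)

/-- The common kernel of a coideal is closed under multiplication: modulo `I ⊗ H + H ⊗ I`, where
`(g ⊗ h) ↦ (g x) (h y)` vanishes, `Δ(h)` is zero. -/
theorem smul_mul_eq_zero (hA : IsModuleAlgebra K H L) {I : Ideal H} (hI : IsLeftIdealCoideal K I)
    {x y : L} (hx : ∀ h ∈ I, h • x = 0) (hy : ∀ h ∈ I, h • y = 0) {h : H} (hh : h ∈ I) :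
    h • (x * y) = 0 := by
  rw [hA.smul_mul]
  have hc := hI.map_mkQ_comul_eq_zero hh
  let p := (I.restrictScalars K).liftQ ((act K H L).flip x) hx
  let q := (I.restrictScalars K).liftQ ((act K H L).flip y) hy
  have hp : (act K H L).flip x = p ∘ₗ (I.restrictScalars K).mkQ := (Submodule.liftQ_mkQ _ _ _).symm
  have hq : (act K H L).flip y = q ∘ₗ (I.restrictScalars K).mkQ := (Submodule.liftQ_mkQ _ _ _).symm
  rw [hp, hq, TensorProduct.map_comp, LinearMap.comp_apply, hc, map_zero, map_zero]

theorem mem_invariants_iff_smul_eq_zero {I : Ideal H} (hI : IsLeftIdealCoideal K I) {x : L} :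
    x ∈ invariants K L (I : Set H) ↔ ∀ h ∈ I, h • x = 0 := by
  rw [mem_invariants]
  refine forall₂_congr fun h hh => ?_
  rw [hI.counit_eq_zero hh, zero_smul]

/-- The invariants `L^I` of a left ideal coideal `I` as an intermediate field; a subalgebra of the
algebraic extension `L / K` is closed under inverses. -/
def fixedField [FiniteDimensional K L] (hA : IsModuleAlgebra K H L) {I : Ideal H}
    (hI : IsLeftIdealCoideal K I) :
    IntermediateField K L :=
  ((invariants K L (I : Set H)).toSubalgebra
    ((mem_invariants_iff_smul_eq_zero hI).2 fun h hh => by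
      rw [hA.smul_one, hI.counit_eq_zero hh, map_zero])
    (fun x y hx hy => by
      rw [mem_invariants_iff_smul_eq_zero hI] at hx hy ⊢
      exact fun h hh => smul_mul_eq_zero hA hI hx hy hh)).toIntermediateField'
    (Subalgebra.isField_of_algebraic _)

theorem mem_fixedField [FiniteDimensional K L] (hA : IsModuleAlgebra K H L) {I : Ideal H}
    (hI : IsLeftIdealCoideal K I) {x : L} : x ∈ fixedField hA hI ↔ ∀ h ∈ I, h • x = 0 :=
  mem_invariants_iff_smul_eq_zero hI

/-- `L·I` is stable under the action of `H`, by `h (c f) = ∑ (h₁ c) (h₂ f)`. -/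
theorem act_comp_mem_span (hA : IsModuleAlgebra K H L) (I : Ideal H) (h : H) {f : L →ₗ[K] L}
    (hf : f ∈ Submodule.span L (act K H L '' (I : Set H))) :
    act K H L h ∘ₗ f ∈ Submodule.span L (act K H L '' (I : Set H)) := by
  set N := Submodule.span L (act K H L '' (I : Set H)) with hN
  -- For `t = Δ(h)` the right-hand side below is `∑ (h₁ c) ((h₂ i) y) = h (c (i y))`.
  have key : ∀ (c : L) (i : H), i ∈ I → ∀ t : H ⊗[K] H, ∃ f ∈ N, ∀ y, f y =
      LinearMap.mul' K L (TensorProduct.map ((act K H L).flip c) ((act K H L).flip (i • y)) t) := by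
    intro c i hi t
    induction t with
    | zero => exact ⟨0, zero_mem _, fun y => by simp⟩
    | add t t' h h' =>
      obtain ⟨f, hf, e⟩ := h
      obtain ⟨f', hf', e'⟩ := h'
      exact ⟨f + f', add_mem hf hf', fun y => by simp [e, e']⟩
    | tmul a b =>
      exact ⟨(a • c) • act K H L (b * i),
        Submodule.smul_mem _ _ (Submodule.subset_span ⟨_, I.mul_mem_left b hi, rfl⟩),
        fun y => by simp [mul_smul]⟩
  induction hf using Submodule.closure_induction with
  | zero => simp
  | add f f' _ _ h h' => rw [LinearMap.comp_add]; exact add_mem h h'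
  | smul_mem c f hf =>
    obtain ⟨i, hi, rfl⟩ := hf
    obtain ⟨f, hf, e⟩ := key c i hi (Coalgebra.comul h)
    convert hf
    ext y
    rw [e, ← hA.smul_mul]
    simp

/-- `L·I` is a left ideal of `End_K(L)`, because `End_K(L)` is spanned over `L` by `H`. -/
theorem comp_mem_span (hG : IsHopfGalois K H L) (I : Ideal H) (φ : L →ₗ[K] L) {f : L →ₗ[K] L}
    (hf : f ∈ Submodule.span L (act K H L '' (I : Set H))) :
    φ ∘ₗ f ∈ Submodule.span L (act K H L '' (I : Set H)) := by
  obtain ⟨t, rfl⟩ := hG.bijective_can.2 φ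
  induction t with
  | zero => simp
  | add t t' h h' => rw [map_add, LinearMap.add_comp]; exact add_mem h h'
  | tmul x h =>
    have : can K H L (x ⊗ₜ[K] h) ∘ₗ f = x • (act K H L h ∘ₗ f) := by
      ext y; simp [can]
    rw [this]
    exact Submodule.smul_mem _ _ (act_comp_mem_span hG.isModuleAlgebra I h hf)

/-- `L·I` contains every endomorphism that vanishes on the common kernel of `I`. -/
theorem mem_span_of_forall [FiniteDimensional K L] (hG : IsHopfGalois K H L) {I : Ideal H}
    (g : L →ₗ[K] L) (hg : ∀ x, (∀ h ∈ I, h • x = 0) → g x = 0) :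
    g ∈ Submodule.span L (act K H L '' (I : Set H)) :=
  mem_of_forall_comp_mem ((Submodule.span L (act K H L '' (I : Set H))).restrictScalars K)
    (fun φ _ hf => comp_mem_span hG I φ hf) g
    fun x hx => hg x fun h hh => hx (act K H L h) (Submodule.subset_span ⟨h, hh, rfl⟩)

theorem annihilator_fixedField [FiniteDimensional K L] (hG : IsHopfGalois K H L) {I : Ideal H}
    (hI : IsLeftIdealCoideal K I) :
    annihilator H (fixedField hG.isModuleAlgebra hI) = I := by
  refine le_antisymm (fun h hh => ?_) fun h hh x hx => (mem_fixedField _ hI).1 hx h hh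
  exact mem_of_apply_mem_span_image (act K H L) hG.bijective_can.1 (I.restrictScalars K)
    (mem_span_of_forall hG _ fun x hx => hh x ((mem_fixedField _ hI).2 hx))

theorem isHSubextension_fixedField [FiniteDimensional K L] (hG : IsHopfGalois K H L) {I : Ideal H}
    (hI : IsLeftIdealCoideal K I) :
    IsHSubextension H (fixedField hG.isModuleAlgebra hI) := by
  rw [isHSubextension_iff hG.bijective_can, annihilator_fixedField hG hI]
  exact fun g hg => mem_span_of_forall hG g fun x hx => hg x ((mem_fixedField _ hI).2 hx)

theorem isLeftIdealCoideal_annihilator (hA : IsModuleAlgebra K H L)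
    {L₀ : IntermediateField K L} (h₀ : IsHSubextension H L₀) :
    IsLeftIdealCoideal K (annihilator H L₀) := by
  set J := (annihilator H L₀).restrictScalars K with hJ
  refine ⟨fun h hh => ?_, fun h hh => ?_⟩
  · have := hh 1 (one_mem L₀)
    rw [hA.smul_one] at this
    exact (algebraMap K L).injective (by rw [this, map_zero])
  · -- Expand the image of `Δ(h)` in `H / J ⊗ H / J` as `∑ cᵢ ⊗ bᵢ`, for a basis `b` of `H / J`.
    let b := Module.Basis.ofVectorSpace K (H ⧸ J)
    have hb : LinearIndependent L fun i => actQuot H L₀ (b i) :=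
      linearIndependent_of_injective_liftBaseChange _ h₀.1 b
    obtain ⟨c, hc⟩ := TensorProduct.eq_repr_basis_right b
      (TensorProduct.map J.mkQ J.mkQ (Coalgebra.comul (R := K) h))
    -- `∑ᵢ (cᵢ x) (bᵢ y) = h (x y) = 0` for all `x, y ∈ L₀`
    have key : ∀ x y : L₀, c.sum (fun i m => actQuot H L₀ m x * actQuot H L₀ (b i) y) = 0 := by
      intro x y
      have h1 := hA.smul_mul h x y
      rw [hh _ (mul_mem x.2 y.2)] at h1
      have hx : (act K H L).flip x = (actQuot H L₀).flip x ∘ₗ J.mkQ := rfl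
      have hy : (act K H L).flip y = (actQuot H L₀).flip y ∘ₗ J.mkQ := rfl
      rw [hx, hy, TensorProduct.map_comp, LinearMap.comp_apply, ← hc] at h1
      simpa [Finsupp.sum] using h1.symm
    -- The maps `bᵢ : L₀ → L` are linearly independent over `L`, so `cᵢ x = 0` for all `x ∈ L₀`.
    have hc0 : c = 0 := by
      ext i
      have hi : ∀ x : L₀, actQuot H L₀ (c i) x = 0 := by
        intro x
        by_cases his : i ∈ c.support
        · refine linearIndependent_iff'.1 hb c.support (fun i => actQuot H L₀ (c i) x)
            (LinearMap.ext fun y => ?_) i his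
          simpa [Finsupp.sum] using key x y
        · simp [Finsupp.notMem_support_iff.1 his]
      obtain ⟨k, hk⟩ := J.mkQ_surjective (c i)
      rw [← hk] at hi ⊢
      exact (Submodule.Quotient.mk_eq_zero J).2 fun x hx => hi ⟨x, hx⟩
    rw [← hc, hc0, Finsupp.sum_zero_index]

end Action

/-! ### The antipode of a finite dimensional bialgebra with injective Galois map -/

section Antipode

variable (K H : Type*) [Field K] [Ring H] [Bialgebra K H]

/-- The Galois map `H ⊗ H → H ⊗ H`, `g ⊗ h ↦ ∑ g₁ ⊗ g₂ h`, of a bialgebra. -/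
def galoisMap : H ⊗[K] H →ₗ[K] H ⊗[K] H :=
  (LinearMap.mul' K H).lTensor H ∘ₗ (TensorProduct.assoc K H H H).toLinearMap ∘ₗ
    (Coalgebra.comul (R := K)).rTensor H

theorem galoisMap_tmul (g h : H) : galoisMap K H (g ⊗ₜ[K] h) =
    (LinearMap.mulRight K h).lTensor H (Coalgebra.comul (R := K) g) := by
  have key : ∀ t : H ⊗[K] H, (LinearMap.mul' K H).lTensor H
      (TensorProduct.assoc K H H H (t ⊗ₜ[K] h)) = (LinearMap.mulRight K h).lTensor H t := by
    intro t
    induction t with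
    | zero => simp
    | add t t' ht ht' => simp only [TensorProduct.add_tmul, map_add, ht, ht']
    | tmul a b => simp
  exact key _

variable {K H}

/-- Right convolution by the identity, `f ↦ (h ↦ ∑ f(h₁) h₂)`. -/
def convId : (H →ₗ[K] H) →ₗ[K] (H →ₗ[K] H) where
  toFun f := LinearMap.mul' K H ∘ₗ f.rTensor H ∘ₗ Coalgebra.comul
  map_add' f g := by ext; simp [LinearMap.rTensor_add]
  map_smul' c f := by ext; simp [LinearMap.rTensor_smul]

/-- `f * id = 0` implies that `g ⊗ h ↦ f(g) h` vanishes on the range of the Galois map, that is,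
everywhere. -/
theorem convId_injective [FiniteDimensional K H] (hβ : Function.Injective (galoisMap K H)) :
    Function.Injective (convId (K := K) (H := H)) := by
  rw [injective_iff_map_eq_zero]
  intro f hf
  have h1 : (LinearMap.mul' K H ∘ₗ f.rTensor H) ∘ₗ galoisMap K H = 0 := by
    refine TensorProduct.ext' fun g h => ?_
    have key : ∀ t : H ⊗[K] H,
        LinearMap.mul' K H (f.rTensor H ((LinearMap.mulRight K h).lTensor H t)) =
          LinearMap.mul' K H (f.rTensor H t) * h := by
      intro t
      induction t with
      | zero => simp
      | add t t' ht ht' => simp only [map_add, ht, ht', add_mul]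
      | tmul a b => simp [mul_assoc]
    have hg : LinearMap.mul' K H (f.rTensor H (Coalgebra.comul (R := K) g)) = 0 :=
      LinearMap.congr_fun hf g
    rw [LinearMap.comp_apply, galoisMap_tmul, LinearMap.comp_apply, key, hg, zero_mul,
      LinearMap.zero_apply]
  ext g
  obtain ⟨t, ht⟩ := LinearMap.injective_iff_surjective.1 hβ (g ⊗ₜ[K] 1)
  have h2 := LinearMap.congr_fun h1 t
  simpa [ht] using h2

/-- If the Galois map is injective, an antipode exists and preserves every two-sided ideal `I` that
is a coideal: right convolution by `id` is bijective on the maps `f` with `f(I) ⊆ I`, so the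
convolution unit has a preimage among them. -/
theorem exists_isAntipode_mapsTo [FiniteDimensional K H]
    (hβ : Function.Injective (galoisMap K H)) {I : Ideal H} [I.IsTwoSided]
    (hI : IsLeftIdealCoideal K I) :
    ∃ S : H →ₗ[K] H, IsAntipode K S ∧ ∀ h ∈ I, S h ∈ I := by
  -- The maps that preserve `I`; `e` below is the convolution unit.
  let A : Submodule K (H →ₗ[K] H) :=
    { carrier := {f | ∀ h ∈ I, f h ∈ I}
      zero_mem' := fun h _ => I.zero_mem
      add_mem' := fun hf hg h hh => I.add_mem (hf h hh) (hg h hh)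
      smul_mem' := fun c f hf h hh => (I.restrictScalars K).smul_mem c (hf h hh) }
  have hA : ∀ f ∈ A, convId f ∈ A := by
    intro f hf h hh
    have hmem := ((Submodule.isCoideal_iff_comul_mem _).1 hI).2 h hh
    obtain ⟨_, ⟨u, rfl⟩, _, ⟨v, rfl⟩, huv⟩ := Submodule.mem_sup.1 hmem
    change LinearMap.mul' K H (f.rTensor H (Coalgebra.comul (R := K) h)) ∈ I
    rw [← huv, map_add, map_add]
    refine I.add_mem ?_ ?_
    · clear huv
      induction u with
      | zero => simp
      | add t t' ht ht' => simp only [map_add]; exact I.add_mem ht ht'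
      | tmul a b => simpa using I.mul_mem_left (f a) b.2
    · clear huv
      induction v with
      | zero => simp
      | add t t' ht ht' => simp only [map_add]; exact I.add_mem ht ht'
      | tmul a b => simpa using I.mul_mem_right b (hf a a.2)
  have hinj := convId_injective hβ
  let e : H →ₗ[K] H := Algebra.linearMap K H ∘ₗ Coalgebra.counit
  have he : e ∈ A := fun h hh => by
    have : e h = 0 := by simp [e, hI.counit_eq_zero hh]
    rw [this]; exact I.zero_mem
  have hres : Function.Injective (convId.restrict hA) := fun f g hfg =>
    Subtype.ext (hinj (congrArg Subtype.val hfg))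
  have hsurj : Function.Surjective (convId.restrict hA) :=
    (LinearMap.injective_iff_surjective (K := K) (V := A)).1 hres
  obtain ⟨⟨S, hSA⟩, hS⟩ := hsurj ⟨e, he⟩
  replace hS : convId S = e := congrArg Subtype.val hS
  refine ⟨S, ⟨fun h => LinearMap.congr_fun hS h, ?_⟩, hSA⟩
  -- It remains to see `id * S = 1`: both sides agree after right convolution by `id`, since
  -- `(id * S) * id = id * (S * id) = id`.
  have h1 : WithConv.toConv S * WithConv.toConv LinearMap.id = 1 := by
    apply WithConv.ofConv_injective; exact hS
  have h2 : WithConv.toConv LinearMap.id * WithConv.toConv S = (1 : WithConv (H →ₗ[K] H)) := by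
    apply WithConv.ofConv_injective
    apply hinj
    have h3 : WithConv.toConv LinearMap.id * WithConv.toConv S * WithConv.toConv LinearMap.id =
      (1 : WithConv (H →ₗ[K] H)) * WithConv.toConv LinearMap.id := by
      rw [mul_assoc, h1, mul_one, one_mul]
    exact congrArg WithConv.ofConv h3
  exact fun h => LinearMap.congr_fun (congrArg WithConv.ofConv h2) h

end Antipode

/-! ### Hopf ideals and stable subextensions -/

section Action

variable {K H L : Type*} [Field K] [Ring H] [Bialgebra K H] [Field L] [Algebra K L]
  [Module H L] [IsScalarTower K H L]

theorem eq_zero_of_smul_eq_zero (hG : Function.Injective (can K H L)) {g : H}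
    (hg : ∀ y : L, g • y = 0) : g = 0 := by
  refine mem_of_apply_mem_span_image (act K H L) hG ⊥ ?_
  have : act K H L g = 0 := LinearMap.ext hg
  rw [this]
  exact zero_mem _

/-- The Galois map composed with `H ⊗ H → L`, `a ⊗ b ↦ (a y) (b z)`. -/
theorem mul'_map_galoisMap (hA : IsModuleAlgebra K H L) (g h : H) (y z : L) :
    LinearMap.mul' K L (TensorProduct.map ((act K H L).flip y) ((act K H L).flip z)
      (galoisMap K H (g ⊗ₜ[K] h))) = g • (y * h • z) := by
  have hz : (act K H L).flip z ∘ₗ LinearMap.mulRight K h = (act K H L).flip (h • z) := by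
    ext a; simp [mul_smul]
  rw [hA.smul_mul, galoisMap_tmul, ← LinearMap.comp_apply (TensorProduct.map _ _),
    LinearMap.map_comp_lTensor, hz]

/-- If `∑ᵢ cᵢ ⊗ bᵢ` is in the kernel of the Galois map, for a basis `b` of `H`, then
`∑ᵢ cᵢ (y (bᵢ z)) = 0` for all `y, z ∈ L`. The `bᵢ` being linearly independent over `L`, the vectors
`(bᵢ z)ᵢ` span `Lⁿ`, and so every `cᵢ` acts by zero. -/
theorem galoisMap_injective [FiniteDimensional K H] (hG : IsHopfGalois K H L) :
    Function.Injective (galoisMap K H) := by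
  rw [injective_iff_map_eq_zero]
  intro t ht
  let b := Module.finBasis K H
  have hb : LinearIndependent L fun i => act K H L (b i) :=
    linearIndependent_of_injective_liftBaseChange _ hG.bijective_can.1 b
  obtain ⟨c, rfl⟩ := TensorProduct.eq_repr_basis_right b t
  rw [Finsupp.sum_fintype _ _ (by simp)] at ht ⊢
  -- `U` contains every `(bᵢ z)ᵢ` and is stable under `L` because `y` is arbitrary, so `U = Lⁿ`.
  let U : Submodule L (Fin (Module.finrank K H) → L) :=
    { carrier := {v | ∀ y : L, ∑ i, c i • (y * v i) = 0}
      zero_mem' := fun y => by simp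
      add_mem' := fun {v w} hv hw y => by
        simp only [Pi.add_apply, mul_add, smul_add, Finset.sum_add_distrib, hv y, hw y, add_zero]
      smul_mem' := fun a v hv y => by simpa [mul_assoc] using hv (y * a) }
  have hU : U = ⊤ := by
    have hb' : LinearIndependent L fun (i : Fin (Module.finrank K H)) (z : L) => b i • z :=
      hb.map' (LinearMap.ltoFun K L L L) (LinearMap.ker_eq_bot.2 DFunLike.coe_injective)
    rw [eq_top_iff, ← span_flip_eq_top_iff_linearIndependent.2 hb', Submodule.span_le]
    rintro _ ⟨z, rfl⟩ y
    have h0 := congrArg (fun s => LinearMap.mul' K L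
      (TensorProduct.map ((act K H L).flip y) ((act K H L).flip z) s)) ht
    simp only [map_sum, mul'_map_galoisMap hG.isModuleAlgebra, map_zero] at h0
    exact h0
  refine Finset.sum_eq_zero fun j _ => ?_
  have hj : c j = 0 := eq_zero_of_smul_eq_zero hG.bijective_can.1 fun y => by
    have hv : Pi.single j 1 ∈ U := hU ▸ Submodule.mem_top
    have := hv y
    rw [Finset.sum_eq_single j] at this
    · simpa using this
    · intro i _ hij
      simp [hij]
    · simp
  rw [hj, TensorProduct.zero_tmul]

theorem isHopfIdeal_annihilator [FiniteDimensional K H] (hG : IsHopfGalois K H L)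
    {L₀ : IntermediateField K L} (h₀ : IsHNormal H L₀) :
    IsHopfIdeal K (annihilator H L₀) := by
  have hc := isLeftIdealCoideal_annihilator hG.isModuleAlgebra h₀.1
  have ht : (annihilator H L₀).IsTwoSided :=
    ⟨fun b ha x hx => by rw [mul_smul]; exact ha _ (h₀.2 b x hx)⟩
  exact ⟨ht, hc, exists_isAntipode_mapsTo (galoisMap_injective hG) hc⟩

theorem isHStable_fixedField [FiniteDimensional K L] (hA : IsModuleAlgebra K H L) {I : Ideal H}
    (hI : IsLeftIdealCoideal K I) [I.IsTwoSided] : IsHStable H (fixedField hA hI) := by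
  intro g x hx
  rw [mem_fixedField] at hx ⊢
  intro h hh
  rw [← mul_smul]
  exact hx _ (I.mul_mem_right g hh)

theorem fixedField_annihilator [FiniteDimensional K L] (hG : IsHopfGalois K H L)
    {L₀ : IntermediateField K L} (h₀ : IsHSubextension H L₀) :
    fixedField hG.isModuleAlgebra (isLeftIdealCoideal_annihilator hG.isModuleAlgebra h₀) = L₀ := by
  ext x
  rw [mem_fixedField, mem_iff_forall_annihilator hG.bijective_can h₀]

theorem annihilator_le_annihilator_iff (hG : Function.Bijective (can K H L))
    {L₀ L₁ : IntermediateField K L} (h₀ : IsHSubextension H L₀) :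
    annihilator H L₀ ≤ annihilator H L₁ ↔ L₁ ≤ L₀ :=
  ⟨fun h _ hx => (mem_iff_forall_annihilator hG h₀).2 fun _ hg => h hg _ hx,
    fun h _ hg x hx => hg x (h hx)⟩

end Action

end HopfGalois

theorem mainTheorem3 (K H L : Type*) [Field K] [Ring H] [Bialgebra K H] [FiniteDimensional K H]
    [Field L] [Algebra K L] [FiniteDimensional K L] [Algebra.IsSeparable K L]
    [Module H L] [IsScalarTower K H L] (hGal : HopfGalois.IsHopfGalois K H L) :
    (∃ e : {L₀ : IntermediateField K L // HopfGalois.IsHSubextension H L₀} ≃o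
          {I : Ideal H // HopfGalois.IsLeftIdealCoideal K I}ᵒᵈ,
        (∀ L₀, (OrderDual.ofDual (e L₀)).1 = HopfGalois.annihilator H L₀.1) ∧
        (∀ I : {I : Ideal H // HopfGalois.IsLeftIdealCoideal K I},
          ((e.symm (OrderDual.toDual I)).1 : Set L) =
            HopfGalois.invariants K L (I.1 : Set H))) ∧
    (∃ e : {L₀ : IntermediateField K L // HopfGalois.IsHNormal H L₀} ≃o
          {I : Ideal H // HopfGalois.IsHopfIdeal K I}ᵒᵈ,
        (∀ L₀, (OrderDual.ofDual (e L₀)).1 = HopfGalois.annihilator H L₀.1) ∧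
        (∀ I : {I : Ideal H // HopfGalois.IsHopfIdeal K I},
          ((e.symm (OrderDual.toDual I)).1 : Set L) =
            HopfGalois.invariants K L (I.1 : Set H))) := by
  have hA := hGal.isModuleAlgebra
  refine ⟨⟨
    { toFun := fun L₀ => OrderDual.toDual ⟨HopfGalois.annihilator H L₀.1,
        HopfGalois.isLeftIdealCoideal_annihilator hA L₀.2⟩
      invFun := fun I => ⟨HopfGalois.fixedField hA (OrderDual.ofDual I).2,
        HopfGalois.isHSubextension_fixedField hGal (OrderDual.ofDual I).2⟩
      left_inv := fun L₀ => Subtype.ext (HopfGalois.fixedField_annihilator hGal L₀.2)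
      right_inv := fun I =>
        Subtype.ext (HopfGalois.annihilator_fixedField hGal (OrderDual.ofDual I).2)
      map_rel_iff' := fun {L₀ L₁} =>
        HopfGalois.annihilator_le_annihilator_iff hGal.bijective_can L₁.2 },
    fun _ => rfl, fun _ => rfl⟩, ⟨
    { toFun := fun L₀ => OrderDual.toDual ⟨HopfGalois.annihilator H L₀.1,
        HopfGalois.isHopfIdeal_annihilator hGal L₀.2⟩
      invFun := fun I => ⟨HopfGalois.fixedField hA (OrderDual.ofDual I).2.isCoideal,
        HopfGalois.isHSubextension_fixedField hGal (OrderDual.ofDual I).2.isCoideal,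
        have := (OrderDual.ofDual I).2.isTwoSided
        HopfGalois.isHStable_fixedField hA (OrderDual.ofDual I).2.isCoideal⟩
      left_inv := fun L₀ => Subtype.ext (HopfGalois.fixedField_annihilator hGal L₀.2.1)
      right_inv := fun I =>
        Subtype.ext (HopfGalois.annihilator_fixedField hGal (OrderDual.ofDual I).2.isCoideal)
      map_rel_iff' := fun {L₀ L₁} =>
        HopfGalois.annihilator_le_annihilator_iff hGal.bijective_can L₁.2.1 },
    fun _ => rfl, fun _ => rfl⟩⟩
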